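/- Let $n \ge 2$ and $p \ge 1$ be integers. For $f : \mathbb{R}^{n\times p} \to \mathbb{R}\cup\{\infty\}$, $X \in \mathbb{R}^{n\times p}$ and $\rho \in \mathbb{R}^p$, let $$L(f : X, \rho) = \frac{1}{\Omega_n}\int_{S_{0,1}} f(X + e\rho^{\top})\, \mathrm{d}s(e),$$ where $S_{0,1} = \{e \in \mathbb{R}^n : \|e\| = 1\}$ is the Euclidean unit sphere, $\mathrm{d}s$ its surface area element and $\Omega_n$ its surface area. The function $f$ is called matrix superharmonic if (i) $f$ is lower semicontinuous; (ii) $f \not\equiv \infty$; (iii) $L(f : X, \rho) \le f(X)$ for every $X \in \mathbb{R}^{n\times p}$ and every $\rho \in \mathbb{R}^p$. Let $c \ge 0$ be real and let $$\pi(M) = \prod_{i=1}^p \Bigl(\sum_{a=1}^n M_{ai}^2\Bigr)^{-c/2}, \qquad M \in \mathbb{R}^{n\times p},$$ where, for $c>0$, $\pi(M)=\infty$ if some column of $M$ is zero, and $\pi \equiv 1$ for $c=0$. Then $\pi$ is matrix superharmonic if and only if $0 \le c \le (n-2)/p$. -/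

import Mathlib

open MeasureTheory

/-- The surface area measure `ds` on the unit sphere `S_{0,1}` of `ℝⁿ` (Euclidean norm).
Its total mass is the surface area `Ω_n`. -/
noncomputable def surfaceMeasure (n : ℕ) :
    Measure (Metric.sphere (0 : EuclideanSpace ℝ (Fin n)) 1) :=
  (volume : Measure (EuclideanSpace ℝ (Fin n))).toSphere

/-- The mean value `(1 / μ(α)) ∫ g dμ` of an extended-real-valued function: the mean of the
positive part minus the mean of the negative part. -/
noncomputable def extendedMean {α : Type*} [MeasurableSpace α] (μ : Measure α) (g : α → EReal) :
    EReal :=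
  ((⨍⁻ x, (g x).toENNReal ∂μ : ENNReal) : EReal) - ((⨍⁻ x, (-g x).toENNReal ∂μ : ENNReal) : EReal)

/-- `L(f : X, ρ) = (1 / Ω_n) ∫_{S_{0,1}} f (X + e ρᵀ) ds(e)`. -/
noncomputable def rankOneMean {n p : ℕ} (f : Matrix (Fin n) (Fin p) ℝ → EReal)
    (X : Matrix (Fin n) (Fin p) ℝ) (ρ : Fin p → ℝ) : EReal :=
  extendedMean (surfaceMeasure n) fun e =>
    f (X + Matrix.vecMulVec (e : EuclideanSpace ℝ (Fin n)).ofLp ρ)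

/-- Matrix superharmonicity of `f : ℝ^{n × p} → ℝ ∪ {∞}`. -/
structure IsMatrixSuperharmonic {n p : ℕ} (f : Matrix (Fin n) (Fin p) ℝ → EReal) : Prop where
  /-- `f` takes values in `ℝ ∪ {∞}`. -/
  ne_bot : ∀ X, f X ≠ ⊥
  lowerSemicontinuous : LowerSemicontinuous f
  exists_ne_top : ∃ X, f X ≠ ⊤
  mean_le : ∀ (X : Matrix (Fin n) (Fin p) ℝ) (ρ : Fin p → ℝ), rankOneMean f X ρ ≤ f X

/-- The column-wise prior `π(M) = ∏ i, (∑ a, M a i ^ 2) ^ (-c / 2)`, with values in `[0, ∞]`: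
for `c > 0` it is `∞` when some column of `M` vanishes, and it is constant `1` for `c = 0`. -/
noncomputable def columnwisePrior (n p : ℕ) (c : ℝ) (M : Matrix (Fin n) (Fin p) ℝ) : EReal :=
  ((∏ i : Fin p, ENNReal.ofReal (∑ a : Fin n, M a i ^ 2) ^ (-c / 2) : ENNReal) : EReal)

/-! A rank-one perturbation moves column `i` from `x_i` to `x_i + ρ_i e`, with the same unit vector
`e` for all columns. For `c * p ≤ n - 2`, Hölder's inequality with `p` equal weights `1/p` bounds
the mean of the product by the product of the means of `‖x_i + ρ_i e‖ ^ (-c p)`, each raised to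
`1/p`; this reduces the claim to superharmonicity of one power of the norm
(`laverage_norm_rpow_le`). Conversely, when all columns and all `ρ_i` agree, the prior is itself `‖x
+ r e‖ ^ (-c p)`, which is strictly subharmonic off the origin once `c * p > n - 2`
(`lt_laverage_norm_rpow`).

Both facts about the norm come from `exists_integral_rpow_sub_eq`: the change of a spherical mean of
`(‖·‖² + ε) ^ (-σ)` is a positive multiple of the integral of its Laplacian over an intermediate
sphere. The divergence theorem is replaced by `integral_sphere_by_parts`, which follows from
rotation invariance of the surface measure. Throughout, `m = n - 2` and `2σ = c p`. -/

/-! ### Differentiating integrals and isometry invariance on the sphere -/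

/-- Differentiation under the integral sign over a compact space. -/
theorem hasDerivAt_integral_of_continuousOn {α : Type*} [TopologicalSpace α] [CompactSpace α]
    [MeasurableSpace α] [OpensMeasurableSpace α] (μ : Measure α) [IsFiniteMeasure μ]
    {F F' : ℝ → α → ℝ} {U : Set ℝ} (hU : IsOpen U)
    (hF : ∀ r ∈ U, Continuous (F r))
    (hF' : ContinuousOn (fun z : ℝ × α => F' z.1 z.2) (U ×ˢ Set.univ))
    (hd : ∀ r ∈ U, ∀ a, HasDerivAt (fun s => F s a) (F' r a) r) {r : ℝ} (hr : r ∈ U) :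
    HasDerivAt (fun s => ∫ a, F s a ∂μ) (∫ a, F' r a ∂μ) r := by
  obtain ⟨δ, hδ, hδU⟩ := Metric.nhds_basis_closedBall.mem_iff.1 (hU.mem_nhds hr)
  -- Compactness in both variables bounds `F'` by a constant, which serves as the dominating
  -- function.
  have hK : IsCompact (Metric.closedBall r δ ×ˢ (Set.univ : Set α)) :=
    (isCompact_closedBall r δ).prod isCompact_univ
  obtain ⟨C, hC⟩ := hK.exists_bound_of_continuousOn
    (hF'.mono (Set.prod_mono hδU subset_rfl))
  have hF'c : Continuous (F' r) := by
    rw [← continuousOn_univ]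
    exact hF'.comp (f := fun a => (r, a)) (by fun_prop) fun a _ => ⟨hr, trivial⟩
  have hint : ∀ {f : α → ℝ}, Continuous f → Integrable f μ := fun hf =>
    hf.integrable_of_hasCompactSupport (HasCompactSupport.of_compactSpace _)
  refine (hasDerivAt_integral_of_dominated_loc_of_deriv_le (bound := fun _ => C)
    (Metric.closedBall_mem_nhds r hδ) ?_ (hint (hF r hr)) (hint hF'c).1 ?_
    (integrable_const C) ?_).2
  · filter_upwards [hU.mem_nhds hr] with s hs using (hint (hF s hs)).1
  · exact .of_forall fun a s hs => hC (s, a) ⟨hs, trivial⟩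
  · exact .of_forall fun a s hs => hd s (hδU hs) a

open scoped Pointwise in
/-- The surface measure is invariant under linear isometries. -/
theorem measurePreserving_sphere_map {E : Type*} [NormedAddCommGroup E] [InnerProductSpace ℝ E]
    [FiniteDimensional ℝ E] [MeasurableSpace E] [BorelSpace E] (T : E ≃ₗᵢ[ℝ] E)
    {τ : Metric.sphere (0 : E) 1 → Metric.sphere (0 : E) 1} (hτ : ∀ e, (τ e : E) = T e) :
    MeasurePreserving τ (volume : Measure E).toSphere (volume : Measure E).toSphere := by
  have hc : Continuous τ := by
    rw [continuous_induced_rng]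
    exact (T.continuous.comp continuous_subtype_val).congr fun e => (hτ e).symm
  refine ⟨hc.measurable, Measure.ext fun s hs => ?_⟩
  rw [Measure.map_apply hc.measurable hs, Measure.toSphere_apply' _ (hc.measurable hs),
    Measure.toSphere_apply' _ hs]
  congr 1
  -- `toSphere` measures a set through the volume of the cone over it, and `T` maps cones to cones.
  have : (Set.Ioo (0 : ℝ) 1 • ((↑) '' (τ ⁻¹' s)) : Set E)
      = T.toMeasurableEquiv ⁻¹' (Set.Ioo (0 : ℝ) 1 • ((↑) '' s)) := by
    ext y
    simp only [Set.mem_smul, Set.mem_image, Set.mem_preimage]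
    constructor
    · rintro ⟨a, ha, _, ⟨e, he, rfl⟩, rfl⟩
      exact ⟨a, ha, _, ⟨τ e, he, rfl⟩, by simp [hτ]⟩
    · rintro ⟨a, ha, _, ⟨e, he, rfl⟩, hy⟩
      have hm : T.symm e ∈ Metric.sphere (0 : E) 1 := by simp
      refine ⟨a, ha, _, ⟨⟨T.symm e, hm⟩, ?_, rfl⟩, ?_⟩
      · have : τ ⟨T.symm e, hm⟩ = e := Subtype.ext (by simp [hτ])
        simpa [this] using he
      · apply T.injective
        simpa using hy
  rw [this, T.measurePreserving.measure_preimage_equiv]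

theorem integral_sphere_comp_isometry {E : Type*} [NormedAddCommGroup E] [InnerProductSpace ℝ E]
    [FiniteDimensional ℝ E] [MeasurableSpace E] [BorelSpace E] (T : E ≃ₗᵢ[ℝ] E) {f : E → ℝ}
    (hf : Continuous fun e : Metric.sphere (0 : E) 1 => f e) :
    ∫ e : Metric.sphere (0 : E) 1, f (T e) ∂(volume : Measure E).toSphere =
      ∫ e : Metric.sphere (0 : E) 1, f e ∂(volume : Measure E).toSphere := by
  have h := measurePreserving_sphere_map T
    (τ := fun e => ⟨T e, by simp⟩) (fun _ => rfl)
  rw [← h.map_eq, integral_map h.measurable.aemeasurable hf.aestronglyMeasurable, h.map_eq]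

/-- Reflection in the hyperplane orthogonal to a unit vector. -/
theorem reflection_orthogonal_unit_apply {E : Type*} [NormedAddCommGroup E]
    [InnerProductSpace ℝ E] {v : E} (hv : ‖v‖ = 1) (x : E) :
    (ℝ ∙ v)ᗮ.reflection x = x - (2 * inner ℝ v x) • v := by
  rw [Submodule.reflection_orthogonal_apply, Submodule.reflection_singleton_apply]
  simp [hv, mul_smul, two_smul]

theorem inner_sphere_mem_Icc {E : Type*} [NormedAddCommGroup E] [InnerProductSpace ℝ E] (x : E)
    (e : Metric.sphere (0 : E) 1) : inner ℝ x (e : E) ∈ Set.Icc (-‖x‖) ‖x‖ := by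
  rw [Set.mem_Icc, ← abs_le]
  refine (abs_real_inner_le_norm _ _).trans ?_
  simp

/-! ### Integration by parts on the sphere -/

/-- The integral of `h ⟪x, e⟫ * ⟪b, e⟫` does not change when `e` is rotated in the plane of `a` and
`b`, so its derivative in the angle vanishes. -/
theorem integral_sphere_rotation_deriv {E : Type*} [NormedAddCommGroup E] [InnerProductSpace ℝ E]
    [FiniteDimensional ℝ E] [MeasurableSpace E] [BorelSpace E] (x a b : E)
    (ha : ‖a‖ = 1) (hb : ‖b‖ = 1) (hab : inner ℝ a b = 0) {h h' : ℝ → ℝ}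
    (hd : ∀ t ∈ Set.Icc (-‖x‖) ‖x‖, HasDerivAt h (h' t) t)
    (hc : ContinuousOn h' (Set.Icc (-‖x‖) ‖x‖)) :
    ∫ e : Metric.sphere (0 : E) 1,
      (h' (inner ℝ x (e : E)) * (inner ℝ a (e : E) * inner ℝ x b - inner ℝ b (e : E) * inner ℝ x a)
        * inner ℝ b (e : E) + h (inner ℝ x (e : E)) * inner ℝ a (e : E))
      ∂(volume : Measure E).toSphere = 0 := by
  have hhc : ContinuousOn h (Set.Icc (-‖x‖) ‖x‖) := fun t ht => (hd t ht).continuousAt.continuousWithinAt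
  have hba : inner ℝ b a = 0 := by rw [real_inner_comm]; exact hab
  have haa : inner ℝ a a = (1 : ℝ) := by rw [real_inner_self_eq_norm_sq, ha]; norm_num
  have hbb : inner ℝ b b = (1 : ℝ) := by rw [real_inner_self_eq_norm_sq, hb]; norm_num
  have hv : ∀ θ : ℝ, ‖Real.cos θ • a + Real.sin θ • b‖ = 1 := by
    intro θ
    have : ‖Real.cos θ • a + Real.sin θ • b‖ ^ 2 = 1 := by
      rw [← real_inner_self_eq_norm_sq]
      simp only [inner_add_left, inner_add_right, inner_smul_left, inner_smul_right, hab, hba,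
        haa, hbb]
      simp only [conj_trivial]
      linarith [Real.sin_sq_add_cos_sq θ]
    exact (pow_eq_one_iff_of_nonneg (norm_nonneg _) two_ne_zero).1 this
  -- Two reflections whose normals make an angle `θ` compose to the rotation by `2θ`; hence the
  -- factor 2 in `h3`.
  let T : ℝ → E ≃ₗᵢ[ℝ] E := fun θ =>
    ((ℝ ∙ a)ᗮ.reflection).trans ((ℝ ∙ (Real.cos θ • a + Real.sin θ • b))ᗮ.reflection)
  let k : ℝ → E → ℝ := fun θ e => -Real.cos θ * inner ℝ a e + Real.sin θ * inner ℝ b e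
  let k' : ℝ → E → ℝ := fun θ e => Real.sin θ * inner ℝ a e + Real.cos θ * inner ℝ b e
  have hT : ∀ θ e, T θ e = e - (2 * inner ℝ a e) • a
      - (2 * k θ e) • (Real.cos θ • a + Real.sin θ • b) := by
    intro θ e
    simp only [T, LinearIsometryEquiv.trans_apply]
    rw [reflection_orthogonal_unit_apply ha, reflection_orthogonal_unit_apply (hv θ)]
    congr 3
    simp only [k, inner_add_left, inner_sub_right, inner_smul_left, inner_smul_right, hba, haa]
    simp only [conj_trivial]
    ring
  -- `W` and `B` are the inner products of the rotated point with `x` and `b`, made explicit in `θ`;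
  -- `W'` and `B'` are their derivatives.
  let W : ℝ → E → ℝ := fun θ e => inner ℝ x e - 2 * inner ℝ a e * inner ℝ x a
      - 2 * k θ e * (Real.cos θ * inner ℝ x a + Real.sin θ * inner ℝ x b)
  let B : ℝ → E → ℝ := fun θ e => inner ℝ b e - 2 * k θ e * Real.sin θ
  let W' : ℝ → E → ℝ := fun θ e =>
      - 2 * k' θ e * (Real.cos θ * inner ℝ x a + Real.sin θ * inner ℝ x b)
      - 2 * k θ e * (-Real.sin θ * inner ℝ x a + Real.cos θ * inner ℝ x b)
  let B' : ℝ → E → ℝ := fun θ e => -2 * k' θ e * Real.sin θ - 2 * k θ e * Real.cos θ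
  have hW : ∀ θ e, inner ℝ x (T θ e) = W θ e := by
    intro θ e
    simp only [hT, W, inner_add_right, inner_sub_right, inner_smul_right]
  have hB : ∀ θ e, inner ℝ b (T θ e) = B θ e := by
    intro θ e
    simp only [hT, B, inner_add_right, inner_sub_right, inner_smul_right, hba, hbb]
    ring
  have hk : ∀ θ e, HasDerivAt (fun s => k s e) (k' θ e) θ := by
    intro θ e
    have := ((Real.hasDerivAt_cos θ).neg.mul_const (inner ℝ a e)).add
      ((Real.hasDerivAt_sin θ).mul_const (inner ℝ b e))
    refine this.congr_deriv ?_
    simp [k']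
  have hWd : ∀ θ e, HasDerivAt (fun s => W s e) (W' θ e) θ := by
    intro θ e
    have := (((hk θ e).const_mul 2).mul (((Real.hasDerivAt_cos θ).mul_const (inner ℝ x a)).add
      ((Real.hasDerivAt_sin θ).mul_const (inner ℝ x b)))).const_sub
        (inner ℝ x e - 2 * inner ℝ a e * inner ℝ x a)
    refine this.congr_deriv ?_
    simp only [W', Pi.add_apply]
    ring
  have hBd : ∀ θ e, HasDerivAt (fun s => B s e) (B' θ e) θ := by
    intro θ e
    have := (((hk θ e).const_mul 2).mul (Real.hasDerivAt_sin θ)).const_sub (inner ℝ b e)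
    refine this.congr_deriv ?_
    simp only [B']
    ring
  have hmem : ∀ (θ : ℝ) (e : Metric.sphere (0 : E) 1), W θ e ∈ Set.Icc (-‖x‖) ‖x‖ := by
    intro θ e
    rw [← hW, Set.mem_Icc, ← abs_le]
    refine (abs_real_inner_le_norm _ _).trans ?_
    simp
  have hWc : Continuous fun z : ℝ × Metric.sphere (0 : E) 1 => W z.1 z.2 := by
    simp only [W, k]; fun_prop
  have hBc : Continuous fun z : ℝ × Metric.sphere (0 : E) 1 => B z.1 z.2 := by
    simp only [B, k]; fun_prop
  have hWc' : Continuous fun z : ℝ × Metric.sphere (0 : E) 1 => W' z.1 z.2 := by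
    simp only [W', k', k]; fun_prop
  have hBc' : Continuous fun z : ℝ × Metric.sphere (0 : E) 1 => B' z.1 z.2 := by
    simp only [B', k', k]; fun_prop
  have h1 : Continuous fun z : ℝ × Metric.sphere (0 : E) 1 => h (W z.1 z.2) :=
    hhc.comp_continuous hWc fun z => hmem _ _
  have h2 : Continuous fun z : ℝ × Metric.sphere (0 : E) 1 => h' (W z.1 z.2) :=
    hc.comp_continuous hWc fun z => hmem _ _
  have key := hasDerivAt_integral_of_continuousOn (volume : Measure E).toSphere isOpen_univ
    (F := fun θ e => h (W θ e) * B θ e)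
    (F' := fun θ e => h' (W θ e) * W' θ e * B θ e + h (W θ e) * B' θ e)
    (fun θ _ => (h1.mul hBc).comp (Continuous.prodMk_right θ))
    (((h2.mul hWc').mul hBc).add (h1.mul hBc')).continuousOn
    (fun θ _ e => ((hd _ (hmem θ e)).comp θ (hWd θ e)).mul (hBd θ e)) (Set.mem_univ 0)
  have hw0 := inner_sphere_mem_Icc x
  have hconst : ∀ θ : ℝ, ∫ e : Metric.sphere (0 : E) 1, h (W θ e) * B θ e
      ∂(volume : Measure E).toSphere = ∫ e : Metric.sphere (0 : E) 1,
        h (inner ℝ x (e : E)) * inner ℝ b (e : E) ∂(volume : Measure E).toSphere := by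
    intro θ
    have := integral_sphere_comp_isometry (T θ) (f := fun e => h (inner ℝ x e) * inner ℝ b e)
      ((hhc.comp_continuous (by fun_prop) hw0).mul (by fun_prop))
    simpa only [hW, hB] using this
  simp only [hconst] at key
  have h0 := key.unique (hasDerivAt_const (0 : ℝ) _)
  have h3 : ∀ e : E, h' (W 0 e) * W' 0 e * B 0 e + h (W 0 e) * B' 0 e
      = 2 * (h' (inner ℝ x e) * (inner ℝ a e * inner ℝ x b - inner ℝ b e * inner ℝ x a)
        * inner ℝ b e + h (inner ℝ x e) * inner ℝ a e) := by
    intro e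
    have hw : W 0 e = inner ℝ x e := by simp [W, k]
    rw [hw]
    simp only [W', B, B', k, k', Real.cos_zero, Real.sin_zero]
    ring
  simp only [h3] at h0
  rw [integral_const_mul] at h0
  linarith

/-- Integration by parts on the sphere for functions of one linear coordinate. -/
theorem integral_sphere_by_parts {n : ℕ} (x : EuclideanSpace ℝ (Fin n)) {h h' : ℝ → ℝ}
    (hd : ∀ t ∈ Set.Icc (-‖x‖) ‖x‖, HasDerivAt h (h' t) t)
    (hc : ContinuousOn h' (Set.Icc (-‖x‖) ‖x‖)) :
    ∫ e, ((n - 1 : ℝ) * (inner ℝ x (e : EuclideanSpace ℝ (Fin n))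
        * h (inner ℝ x (e : EuclideanSpace ℝ (Fin n))))
      - (‖x‖ ^ 2 - inner ℝ x (e : EuclideanSpace ℝ (Fin n)) ^ 2)
        * h' (inner ℝ x (e : EuclideanSpace ℝ (Fin n)))) ∂surfaceMeasure n = 0 := by
  have hhc : ContinuousOn h (Set.Icc (-‖x‖) ‖x‖) :=
    fun t ht => (hd t ht).continuousAt.continuousWithinAt
  have hw0 := inner_sphere_mem_Icc x
  have h1 : Continuous fun e : Metric.sphere (0 : EuclideanSpace ℝ (Fin n)) 1 =>
      h (inner ℝ x (e : EuclideanSpace ℝ (Fin n))) := hhc.comp_continuous (by fun_prop) hw0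
  have h2 : Continuous fun e : Metric.sphere (0 : EuclideanSpace ℝ (Fin n)) 1 =>
      h' (inner ℝ x (e : EuclideanSpace ℝ (Fin n))) := hc.comp_continuous (by fun_prop) hw0
  -- Rotation in the coordinate plane `(i, j)`, weighted by `x i`. The indicator kills the diagonal,
  -- so each `i` has `n - 1` partners, the source of the factor `n - 1`.
  have hij : ∀ i j : Fin n, ∫ e : Metric.sphere (0 : EuclideanSpace ℝ (Fin n)) 1,
      x i * (h' (inner ℝ x (e : EuclideanSpace ℝ (Fin n)))
        * (e.1 i * x j - e.1 j * x i) * e.1 j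
        + (if i = j then 0 else 1) * (h (inner ℝ x (e : EuclideanSpace ℝ (Fin n))) * e.1 i))
      ∂surfaceMeasure n = 0 := by
    intro i j
    rw [integral_const_mul]
    by_cases hne : i = j
    · subst hne
      simp
    · have := integral_sphere_rotation_deriv x (EuclideanSpace.single i 1)
        (EuclideanSpace.single j 1) (by simp) (by simp)
        (by simp [EuclideanSpace.inner_single_left, hne]) hd hc
      simp only [EuclideanSpace.inner_single_left, EuclideanSpace.inner_single_right, map_one,
        one_mul, conj_trivial] at this
      simp only [if_neg hne, one_mul]
      rw [surfaceMeasure, this, mul_zero]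
  have hint : ∀ i j : Fin n, Integrable (fun e : Metric.sphere (0 : EuclideanSpace ℝ (Fin n)) 1 =>
      x i * (h' (inner ℝ x (e : EuclideanSpace ℝ (Fin n)))
        * (e.1 i * x j - e.1 j * x i) * e.1 j
        + (if i = j then 0 else 1) * (h (inner ℝ x (e : EuclideanSpace ℝ (Fin n))) * e.1 i)))
      (surfaceMeasure n) := by
    intro i j
    have : IsFiniteMeasure (surfaceMeasure n) := by unfold surfaceMeasure; infer_instance
    have hcoord : ∀ l : Fin n, Continuous
        fun e : Metric.sphere (0 : EuclideanSpace ℝ (Fin n)) 1 => e.1 l := fun l => by fun_prop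
    exact Continuous.integrable_of_hasCompactSupport (continuous_const.mul
      (((h2.mul (by fun_prop)).mul (hcoord j)).add (continuous_const.mul (h1.mul (hcoord i)))))
      (HasCompactSupport.of_compactSpace _)
  have hsum : ∑ i, ∑ j, ∫ e : Metric.sphere (0 : EuclideanSpace ℝ (Fin n)) 1,
      x i * (h' (inner ℝ x (e : EuclideanSpace ℝ (Fin n)))
        * (e.1 i * x j - e.1 j * x i) * e.1 j
        + (if i = j then 0 else 1) * (h (inner ℝ x (e : EuclideanSpace ℝ (Fin n))) * e.1 i))
      ∂surfaceMeasure n = 0 :=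
    Finset.sum_eq_zero fun i _ => Finset.sum_eq_zero fun j _ => hij i j
  simp_rw [← integral_finsetSum _ fun j _ => hint _ j] at hsum
  rw [← integral_finsetSum _ fun i _ => integrable_finsetSum _ fun j _ => hint i j] at hsum
  rw [← hsum]
  refine integral_congr_ae (.of_forall fun e => ?_)
  have hw : inner ℝ x (e : EuclideanSpace ℝ (Fin n)) = ∑ i, x i * e.1 i := by
    simp [PiLp.inner_apply, mul_comm]
  have hx : ‖x‖ ^ 2 = ∑ i, x i * x i := by
    rw [EuclideanSpace.real_norm_sq_eq]; simp only [sq]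
  have he : ∑ i, e.1 i * e.1 i = 1 := by
    have := EuclideanSpace.real_norm_sq_eq e.1
    simp only [sq] at this
    rw [← this]; simp
  set w := inner ℝ x (e : EuclideanSpace ℝ (Fin n))
  have e1 : ∑ i, ∑ j, (x i * e.1 i) * (x j * e.1 j) = w ^ 2 := by
    rw [← Finset.sum_mul_sum, ← hw, sq]
  have e2 : ∑ i, ∑ j, (x i * x i) * (e.1 j * e.1 j) = ‖x‖ ^ 2 := by
    rw [← Finset.sum_mul_sum, ← hx, he, mul_one]
  have e3 : ∑ i : Fin n, ∑ j : Fin n, (if i = j then (0 : ℝ) else 1) * (x i * e.1 i)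
      = (n - 1) * w := by
    rw [hw, Finset.mul_sum]
    refine Finset.sum_congr rfl fun i _ => ?_
    rw [← Finset.sum_mul]
    congr 1
    have : ∀ j : Fin n, (if i = j then (0 : ℝ) else 1) = 1 - if i = j then 1 else 0 := by
      intro j; split_ifs <;> simp
    simp [this]
  calc _ = h' w * w ^ 2 - h' w * ‖x‖ ^ 2 + h w * ((n - 1) * w) := by ring
    _ = _ := by
      rw [← e1, ← e2, ← e3]
      simp only [Finset.mul_sum, ← Finset.sum_sub_distrib, ← Finset.sum_add_distrib]
      exact Finset.sum_congr rfl fun i _ => Finset.sum_congr rfl fun j _ => by ring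

/-! ### Spherical means of powers of the regularized squared norm -/

instance isFiniteMeasure_surfaceMeasure (n : ℕ) : IsFiniteMeasure (surfaceMeasure n) := by
  unfold surfaceMeasure; infer_instance

/-- The value `‖x + r e‖² + ε` for a unit vector `e` with `⟪x, e⟫ = t`. -/
noncomputable def shiftedNormSq {n : ℕ} (x : EuclideanSpace ℝ (Fin n)) (ε r t : ℝ) : ℝ :=
  ‖x‖ ^ 2 + ε + r ^ 2 + 2 * r * t

theorem norm_add_smul_sphere_sq {n : ℕ} (x : EuclideanSpace ℝ (Fin n)) (r : ℝ)
    (e : Metric.sphere (0 : EuclideanSpace ℝ (Fin n)) 1) :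
    ‖x + r • (e : EuclideanSpace ℝ (Fin n))‖ ^ 2
      = shiftedNormSq x 0 r (inner ℝ x (e : EuclideanSpace ℝ (Fin n))) := by
  rw [norm_add_sq_real, norm_smul, inner_smul_right, shiftedNormSq]
  simp
  ring

/-- For `r ≥ 0` the minimum over `t` is at `t = -‖x‖`, with value `(‖x‖ - r) ^ 2 + ε`. -/
theorem shiftedNormSq_pos {n : ℕ} (x : EuclideanSpace ℝ (Fin n)) {ε r t : ℝ} (hr : 0 ≤ r)
    (hε : 0 < (‖x‖ - r) ^ 2 + ε) (ht : t ∈ Set.Icc (-‖x‖) ‖x‖) : 0 < shiftedNormSq x ε r t := by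
  unfold shiftedNormSq
  nlinarith [mul_le_mul_of_nonneg_left ht.1 hr]

theorem hasDerivAt_shiftedNormSq_rpow_radius {n : ℕ} (x : EuclideanSpace ℝ (Fin n)) {ε r t : ℝ}
    (h : 0 < shiftedNormSq x ε r t) (a : ℝ) :
    HasDerivAt (fun s => shiftedNormSq x ε s t ^ a)
      (2 * a * ((r + t) * shiftedNormSq x ε r t ^ (a - 1))) r := by
  have h1 : HasDerivAt (fun s => shiftedNormSq x ε s t) (2 * r + 2 * t) r := by
    unfold shiftedNormSq
    have := (((hasDerivAt_pow 2 r).const_add (‖x‖ ^ 2 + ε)).add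
      (((hasDerivAt_id r).const_mul 2).mul_const t))
    refine this.congr_deriv ?_
    simp
  refine (h1.rpow_const (Or.inl h.ne')).congr_deriv ?_
  ring

theorem hasDerivAt_shiftedNormSq_rpow_inner {n : ℕ} (x : EuclideanSpace ℝ (Fin n)) {ε r t : ℝ}
    (h : 0 < shiftedNormSq x ε r t) (a : ℝ) :
    HasDerivAt (fun u => shiftedNormSq x ε r u ^ a)
      (2 * r * a * shiftedNormSq x ε r t ^ (a - 1)) t := by
  have h1 : HasDerivAt (fun u => shiftedNormSq x ε r u) (2 * r) t := by
    unfold shiftedNormSq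
    simpa using ((hasDerivAt_id t).const_mul (2 * r)).const_add (‖x‖ ^ 2 + ε + r ^ 2)
  refine (h1.rpow_const (Or.inl h.ne')).congr_deriv ?_
  ring

theorem continuousOn_shiftedNormSq_rpow {n : ℕ} (x : EuclideanSpace ℝ (Fin n)) (ε a : ℝ)
    {U : Set ℝ} (hU : ∀ r ∈ U, ∀ t ∈ Set.Icc (-‖x‖) ‖x‖, 0 < shiftedNormSq x ε r t) :
    ContinuousOn (fun z : ℝ × Metric.sphere (0 : EuclideanSpace ℝ (Fin n)) 1 =>
      shiftedNormSq x ε z.1 (inner ℝ x (z.2 : EuclideanSpace ℝ (Fin n))) ^ a)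
      (U ×ˢ Set.univ) := by
  refine ContinuousOn.rpow_const ?_ fun z hz => Or.inl (hU _ hz.1 _ (inner_sphere_mem_Icc x z.2)).ne'
  unfold shiftedNormSq
  fun_prop

theorem continuous_shiftedNormSq_rpow {n : ℕ} (x : EuclideanSpace ℝ (Fin n)) {ε r : ℝ} (a : ℝ)
    (hr : ∀ t ∈ Set.Icc (-‖x‖) ‖x‖, 0 < shiftedNormSq x ε r t) :
    Continuous fun e : Metric.sphere (0 : EuclideanSpace ℝ (Fin n)) 1 =>
      shiftedNormSq x ε r (inner ℝ x (e : EuclideanSpace ℝ (Fin n))) ^ a := by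
  refine Continuous.rpow_const ?_ fun e => Or.inl (hr _ (inner_sphere_mem_Icc x e)).ne'
  unfold shiftedNormSq
  fun_prop

theorem integrable_sphere {n : ℕ} {f : Metric.sphere (0 : EuclideanSpace ℝ (Fin n)) 1 → ℝ}
    (hf : Continuous f) : Integrable f (surfaceMeasure n) :=
  hf.integrable_of_hasCompactSupport (HasCompactSupport.of_compactSpace _)

/-- The flux identity behind the radial derivative of spherical means of
`(‖·‖² + ε) ^ (a + 1)`. -/
theorem integral_flux_identity {m : ℕ} (x : EuclideanSpace ℝ (Fin (m + 2))) {ε r : ℝ} (a : ℝ)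
    (hr : ∀ t ∈ Set.Icc (-‖x‖) ‖x‖, 0 < shiftedNormSq x ε r t) :
    (m + 1) * ∫ e, (r + inner ℝ x (e : EuclideanSpace ℝ (Fin (m + 2))))
          * shiftedNormSq x ε r (inner ℝ x (e : EuclideanSpace ℝ (Fin (m + 2)))) ^ a
          ∂surfaceMeasure (m + 2)
      + r * ∫ e, (shiftedNormSq x ε r (inner ℝ x (e : EuclideanSpace ℝ (Fin (m + 2)))) ^ a
          + (r + inner ℝ x (e : EuclideanSpace ℝ (Fin (m + 2))))
            * (2 * a * ((r + inner ℝ x (e : EuclideanSpace ℝ (Fin (m + 2))))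
              * shiftedNormSq x ε r (inner ℝ x (e : EuclideanSpace ℝ (Fin (m + 2)))) ^ (a - 1))))
          ∂surfaceMeasure (m + 2)
      = r * ∫ e, ((m + 2) * shiftedNormSq x ε r (inner ℝ x (e : EuclideanSpace ℝ (Fin (m + 2))))
          + 2 * a * (shiftedNormSq x ε r (inner ℝ x (e : EuclideanSpace ℝ (Fin (m + 2)))) - ε))
          * shiftedNormSq x ε r (inner ℝ x (e : EuclideanSpace ℝ (Fin (m + 2)))) ^ (a - 1)
          ∂surfaceMeasure (m + 2) := by
  have hibp := integral_sphere_by_parts x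
    (fun t ht => hasDerivAt_shiftedNormSq_rpow_inner x (hr t ht) a)
    (by
      refine continuousOn_const.mul (ContinuousOn.rpow_const ?_ fun t ht => Or.inl (hr t ht).ne')
      unfold shiftedNormSq
      fun_prop)
  have c1 := continuous_shiftedNormSq_rpow x a hr
  have c2 := continuous_shiftedNormSq_rpow x (a - 1) hr
  have cw : Continuous fun e : Metric.sphere (0 : EuclideanSpace ℝ (Fin (m + 2))) 1 =>
    inner ℝ x (e : EuclideanSpace ℝ (Fin (m + 2))) := by fun_prop
  have cq : Continuous fun e : Metric.sphere (0 : EuclideanSpace ℝ (Fin (m + 2))) 1 =>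
      shiftedNormSq x ε r (inner ℝ x (e : EuclideanSpace ℝ (Fin (m + 2)))) := by
    unfold shiftedNormSq; fun_prop
  rw [← integral_const_mul, ← integral_const_mul, ← integral_const_mul,
    ← integral_add (integrable_sphere (by fun_prop)) (integrable_sphere (by fun_prop)),
    ← sub_eq_zero, ← integral_sub (integrable_sphere (by fun_prop))
      (integrable_sphere (by fun_prop)), ← hibp]
  refine integral_congr_ae (.of_forall fun e => ?_)
  have hpos := hr _ (inner_sphere_mem_Icc x e)
  have hq : shiftedNormSq x ε r (inner ℝ x (e : EuclideanSpace ℝ (Fin (m + 2)))) ^ a =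
      shiftedNormSq x ε r (inner ℝ x (e : EuclideanSpace ℝ (Fin (m + 2)))) *
      shiftedNormSq x ε r (inner ℝ x (e : EuclideanSpace ℝ (Fin (m + 2)))) ^ (a - 1) := by
    rw [Real.rpow_sub_one hpos.ne']
    field_simp
  simp only [hq]
  generalize shiftedNormSq x ε r (inner ℝ x (e : EuclideanSpace ℝ (Fin (m + 2)))) ^ (a - 1) = z
  unfold shiftedNormSq
  push_cast
  ring

/-- Mean value form of the variation of the spherical means of `(‖·‖² + ε) ^ (-σ)`. -/
theorem exists_integral_rpow_sub_eq {m : ℕ} (x : EuclideanSpace ℝ (Fin (m + 2))) {ε R σ : ℝ}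
    {U : Set ℝ} (hU : IsOpen U) (hR : 0 < R) (hRU : Set.Icc 0 R ⊆ U)
    (hq : ∀ r ∈ U, ∀ t ∈ Set.Icc (-‖x‖) ‖x‖, 0 < shiftedNormSq x ε r t) :
    ∃ ξ ∈ Set.Ioo 0 R, ∃ c > 0,
      (∫ e, shiftedNormSq x ε R (inner ℝ x (e : EuclideanSpace ℝ (Fin (m + 2)))) ^ (-σ)
          ∂surfaceMeasure (m + 2))
        - ∫ e, shiftedNormSq x ε 0 (inner ℝ x (e : EuclideanSpace ℝ (Fin (m + 2)))) ^ (-σ)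
          ∂surfaceMeasure (m + 2)
      = - σ * c * ∫ e,
          ((m + 2) * shiftedNormSq x ε ξ (inner ℝ x (e : EuclideanSpace ℝ (Fin (m + 2))))
          + 2 * (-σ - 1) * (shiftedNormSq x ε ξ (inner ℝ x (e : EuclideanSpace ℝ (Fin (m + 2)))) - ε))
          * shiftedNormSq x ε ξ (inner ℝ x (e : EuclideanSpace ℝ (Fin (m + 2)))) ^ (-σ - 1 - 1)
          ∂surfaceMeasure (m + 2) := by
  -- Up to the factor `-2σ`, the radial derivative of the spherical integral.
  set J : ℝ → ℝ := fun r => ∫ e, (r + inner ℝ x (e : EuclideanSpace ℝ (Fin (m + 2))))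
    * shiftedNormSq x ε r (inner ℝ x (e : EuclideanSpace ℝ (Fin (m + 2)))) ^ (-σ - 1)
    ∂surfaceMeasure (m + 2) with hJ
  have hφ : ∀ r ∈ U, HasDerivAt (fun r => ∫ e,
      shiftedNormSq x ε r (inner ℝ x (e : EuclideanSpace ℝ (Fin (m + 2)))) ^ (-σ)
      ∂surfaceMeasure (m + 2)) (2 * (-σ) * J r) r := by
    intro r hr
    have := hasDerivAt_integral_of_continuousOn (surfaceMeasure (m + 2)) hU
      (fun r hr => continuous_shiftedNormSq_rpow x (-σ) (hq r hr))
      (F' := fun r e => 2 * (-σ) * ((r + inner ℝ x (e : EuclideanSpace ℝ (Fin (m + 2))))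
        * shiftedNormSq x ε r (inner ℝ x (e : EuclideanSpace ℝ (Fin (m + 2)))) ^ (-σ - 1)))
      (continuousOn_const.mul (ContinuousOn.mul (by fun_prop)
        (continuousOn_shiftedNormSq_rpow x ε (-σ - 1) hq)))
      (fun r hr e => hasDerivAt_shiftedNormSq_rpow_radius x
        (hq r hr _ (inner_sphere_mem_Icc x e)) (-σ)) hr
    rwa [integral_const_mul] at this
  have hJd : ∀ r ∈ U, HasDerivAt J (∫ e,
      (shiftedNormSq x ε r (inner ℝ x (e : EuclideanSpace ℝ (Fin (m + 2)))) ^ (-σ - 1)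
      + (r + inner ℝ x (e : EuclideanSpace ℝ (Fin (m + 2))))
        * (2 * (-σ - 1) * ((r + inner ℝ x (e : EuclideanSpace ℝ (Fin (m + 2))))
        * shiftedNormSq x ε r (inner ℝ x (e : EuclideanSpace ℝ (Fin (m + 2)))) ^ (-σ - 1 - 1))))
      ∂surfaceMeasure (m + 2)) r := by
    intro r hr
    have h1 := continuousOn_shiftedNormSq_rpow x ε (-σ - 1) hq
    have h2 := continuousOn_shiftedNormSq_rpow x ε (-σ - 1 - 1) hq
    refine hasDerivAt_integral_of_continuousOn (surfaceMeasure (m + 2)) hU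
      (fun r hr => Continuous.mul (by fun_prop)
        (continuous_shiftedNormSq_rpow x (-σ - 1) (hq r hr)))
      (F' := fun r e =>
        shiftedNormSq x ε r (inner ℝ x (e : EuclideanSpace ℝ (Fin (m + 2)))) ^ (-σ - 1)
      + (r + inner ℝ x (e : EuclideanSpace ℝ (Fin (m + 2))))
        * (2 * (-σ - 1) * ((r + inner ℝ x (e : EuclideanSpace ℝ (Fin (m + 2))))
        * shiftedNormSq x ε r (inner ℝ x (e : EuclideanSpace ℝ (Fin (m + 2)))) ^ (-σ - 1 - 1))))
      (h1.add (ContinuousOn.mul (by fun_prop)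
        (continuousOn_const.mul (ContinuousOn.mul (by fun_prop) h2))))
      (fun r hr e => ?_) hr
    have := ((hasDerivAt_id r).add_const
      (inner ℝ x (e : EuclideanSpace ℝ (Fin (m + 2))))).mul
      (hasDerivAt_shiftedNormSq_rpow_radius x (hq r hr _ (inner_sphere_mem_Icc x e)) (-σ - 1))
    refine this.congr_deriv ?_
    simp
  -- `r ^ (m + 1) * J r` is, up to a constant, the flux of the gradient through the sphere of radius
  -- `r`. The integral on the right is the Laplacian's, without its factor `-2σ`.
  have hψ : ∀ r ∈ U, HasDerivAt (fun r => r ^ (m + 1) * J r) (r ^ (m + 1) * ∫ e,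
      ((m + 2) * shiftedNormSq x ε r (inner ℝ x (e : EuclideanSpace ℝ (Fin (m + 2))))
      + 2 * (-σ - 1) * (shiftedNormSq x ε r (inner ℝ x (e : EuclideanSpace ℝ (Fin (m + 2)))) - ε))
      * shiftedNormSq x ε r (inner ℝ x (e : EuclideanSpace ℝ (Fin (m + 2)))) ^ (-σ - 1 - 1)
      ∂surfaceMeasure (m + 2)) r := by
    intro r hr
    refine ((hasDerivAt_pow (m + 1) r).mul (hJd r hr)).congr_deriv ?_
    have := congrArg (r ^ m * ·) (integral_flux_identity x (-σ - 1) (hq r hr))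
    push_cast
    simp only [pow_succ] at this ⊢
    linear_combination this
  -- The mean value theorem is used twice: for the spherical integral on `[0, R]`, then for the
  -- flux, which vanishes at `0`, on `[0, η]`.
  obtain ⟨η, hη, hη'⟩ := exists_hasDerivAt_eq_slope _ _ hR
    (fun r hr => (hφ r (hRU hr)).continuousAt.continuousWithinAt)
    (fun r hr => hφ r (hRU ⟨hr.1.le, hr.2.le⟩))
  have hsub : ∀ r, 0 ≤ r → r ≤ η → r ∈ U := fun r h0 h1 => hRU ⟨h0, h1.trans hη.2.le⟩
  obtain ⟨ξ, hξ, hξ'⟩ := exists_hasDerivAt_eq_slope _ _ hη.1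
    (fun r hr => (hψ r (hsub r hr.1 hr.2)).continuousAt.continuousWithinAt)
    (fun r hr => hψ r (hsub r hr.1.le hr.2.le))
  have hη0 := hη.1
  have hξ0 := hξ.1
  refine ⟨ξ, ⟨hξ.1, hξ.2.trans hη.2⟩, R * 2 * (η * ξ ^ (m + 1) / η ^ (m + 1)), by positivity, ?_⟩
  rw [eq_div_iff (by linarith)] at hη'
  rw [eq_div_iff (by linarith)] at hξ'
  rw [sub_zero] at hη' hξ'
  simp only [zero_pow (Nat.succ_ne_zero m), zero_mul, sub_zero] at hξ'
  have hηm : η ^ (m + 1) ≠ 0 := by positivity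
  rw [← hη']
  have hJη : J η = η * ξ ^ (m + 1) / η ^ (m + 1) * ∫ e,
      ((m + 2) * shiftedNormSq x ε ξ (inner ℝ x (e : EuclideanSpace ℝ (Fin (m + 2))))
      + 2 * (-σ - 1) * (shiftedNormSq x ε ξ (inner ℝ x (e : EuclideanSpace ℝ (Fin (m + 2)))) - ε))
      * shiftedNormSq x ε ξ (inner ℝ x (e : EuclideanSpace ℝ (Fin (m + 2)))) ^ (-σ - 1 - 1)
      ∂surfaceMeasure (m + 2) := by
    rw [div_mul_eq_mul_div, eq_div_iff hηm]
    linear_combination -hξ'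
  rw [hJη]
  ring

theorem integral_shiftedNormSq_zero {n : ℕ} (x : EuclideanSpace ℝ (Fin n)) (ε a : ℝ) :
    ∫ e, shiftedNormSq x ε 0 (inner ℝ x (e : EuclideanSpace ℝ (Fin n))) ^ a ∂surfaceMeasure n
      = (surfaceMeasure n).real Set.univ * (‖x‖ ^ 2 + ε) ^ a := by
  simp [shiftedNormSq]

/-- With `q` the regularized squared norm, the Laplacian has the sign of `-σ * ((m - 2σ) q + 2 (σ +
1) ε)`, hence is nonpositive. Taking `ε > 0` allows spheres that meet or enclose the origin. -/
theorem integral_shiftedNormSq_rpow_le {m : ℕ} (x : EuclideanSpace ℝ (Fin (m + 2))) {ε r σ : ℝ}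
    (hε : 0 < ε) (hr : 0 ≤ r) (hσ : 0 ≤ σ) (hσm : 2 * σ ≤ m) :
    ∫ e, shiftedNormSq x ε r (inner ℝ x (e : EuclideanSpace ℝ (Fin (m + 2)))) ^ (-σ)
        ∂surfaceMeasure (m + 2)
      ≤ (surfaceMeasure (m + 2)).real Set.univ * (‖x‖ ^ 2 + ε) ^ (-σ) := by
  rw [← integral_shiftedNormSq_zero]
  rcases hr.eq_or_lt with rfl | hr
  · exact le_rfl
  have hpos : ∀ r : ℝ, ∀ t ∈ Set.Icc (-‖x‖) ‖x‖, 0 < shiftedNormSq x ε r t := by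
    intro r t ht
    have := abs_le.2 ht
    unfold shiftedNormSq
    nlinarith [sq_nonneg (‖x‖ - |r|), sq_abs r, neg_abs_le (r * t), abs_mul r t,
      mul_le_mul_of_nonneg_left this (abs_nonneg r)]
  obtain ⟨ξ, hξ, c, hc, h⟩ := exists_integral_rpow_sub_eq x (σ := σ) isOpen_univ hr
    (Set.subset_univ _) (fun r _ => hpos r)
  rw [← sub_nonpos, h, neg_mul, neg_mul, neg_nonpos]
  refine mul_nonneg (by positivity) (integral_nonneg fun e => ?_)
  have hq := hpos ξ _ (inner_sphere_mem_Icc x e)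
  refine mul_nonneg ?_ (Real.rpow_nonneg hq.le _)
  nlinarith

/-- The ball of radius `r` about `x` misses the origin, so `ε = 0` is allowed; the Laplacian is then
a positive multiple of `σ * (2σ - m) * q ^ (-σ - 1)`, hence positive. -/
theorem lt_integral_shiftedNormSq_rpow {m : ℕ} (x : EuclideanSpace ℝ (Fin (m + 2))) {r σ : ℝ}
    (hr : 0 < r) (hrx : r < ‖x‖) (hσ : 0 < σ) (hσm : m < 2 * σ) :
    (surfaceMeasure (m + 2)).real Set.univ * (‖x‖ ^ 2) ^ (-σ) <
      ∫ e, shiftedNormSq x 0 r (inner ℝ x (e : EuclideanSpace ℝ (Fin (m + 2)))) ^ (-σ)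
        ∂surfaceMeasure (m + 2) := by
  have hpos : ∀ r ∈ Set.Ioo (-‖x‖) ‖x‖, ∀ t ∈ Set.Icc (-‖x‖) ‖x‖, 0 < shiftedNormSq x 0 r t := by
    intro r hr t ht
    have := abs_le.2 ht
    have hr := abs_lt.2 hr
    unfold shiftedNormSq
    nlinarith [pow_pos (sub_pos.2 hr) 2, sq_abs r, neg_abs_le (r * t), abs_mul r t,
      mul_le_mul_of_nonneg_left this (abs_nonneg r)]
  obtain ⟨ξ, hξ, c, hc, h⟩ := exists_integral_rpow_sub_eq x (σ := σ) isOpen_Ioo hr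
    (fun s hs => ⟨by linarith [hs.1], by linarith [hs.2]⟩) hpos
  have h0 := integral_shiftedNormSq_zero x 0 (-σ)
  rw [add_zero] at h0
  rw [← h0, ← sub_pos, h]
  have hξ' : ∀ t ∈ Set.Icc (-‖x‖) ‖x‖, 0 < shiftedNormSq x 0 ξ t :=
    hpos ξ ⟨by linarith [hξ.1], by linarith [hξ.2]⟩
  have hcont := continuous_shiftedNormSq_rpow x (-σ - 1) hξ'
  have hI : 0 < ∫ e, shiftedNormSq x 0 ξ (inner ℝ x (e : EuclideanSpace ℝ (Fin (m + 2)))) ^ (-σ - 1)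
      ∂surfaceMeasure (m + 2) := by
    have : (surfaceMeasure (m + 2)).IsOpenPosMeasure := by unfold surfaceMeasure; infer_instance
    let e₀ : Metric.sphere (0 : EuclideanSpace ℝ (Fin (m + 2))) 1 :=
      ⟨EuclideanSpace.single 0 1, by simp⟩
    exact hcont.integral_pos_of_hasCompactSupport_nonneg_nonzero
      (HasCompactSupport.of_compactSpace _)
      (fun e => Real.rpow_nonneg (hξ' _ (inner_sphere_mem_Icc x e)).le _)
      (x := e₀) (Real.rpow_pos_of_pos (hξ' _ (inner_sphere_mem_Icc x e₀)) _).ne'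
  have hint : ∫ e,
      ((m + 2) * shiftedNormSq x 0 ξ (inner ℝ x (e : EuclideanSpace ℝ (Fin (m + 2))))
      + 2 * (-σ - 1) * (shiftedNormSq x 0 ξ (inner ℝ x (e : EuclideanSpace ℝ (Fin (m + 2)))) - 0))
      * shiftedNormSq x 0 ξ (inner ℝ x (e : EuclideanSpace ℝ (Fin (m + 2)))) ^ (-σ - 1 - 1)
      ∂surfaceMeasure (m + 2) = (m - 2 * σ) * ∫ e,
        shiftedNormSq x 0 ξ (inner ℝ x (e : EuclideanSpace ℝ (Fin (m + 2)))) ^ (-σ - 1)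
        ∂surfaceMeasure (m + 2) := by
    rw [← integral_const_mul]
    refine integral_congr_ae (.of_forall fun e => ?_)
    have hq := hξ' _ (inner_sphere_mem_Icc x e)
    simp only [Real.rpow_sub_one hq.ne' (-σ - 1)]
    field_simp
    ring
  rw [hint]
  have := mul_pos (mul_pos (mul_pos hσ hc) (sub_pos.2 hσm)) hI
  linarith

/-! ### Mean value inequalities with values in `[0, ∞]` -/

/-- Fatou's lemma along `ε = 1 / (k + 1)`: the regularized means are all bounded by the
unregularized value at the centre. -/
theorem lintegral_norm_rpow_le {m : ℕ} (x : EuclideanSpace ℝ (Fin (m + 2))) (r : ℝ) {σ : ℝ}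
    (hσ : 0 ≤ σ) (hσm : 2 * σ ≤ m) :
    ∫⁻ e, ENNReal.ofReal (‖x + r • (e : EuclideanSpace ℝ (Fin (m + 2)))‖ ^ 2) ^ (-σ)
        ∂surfaceMeasure (m + 2)
      ≤ surfaceMeasure (m + 2) Set.univ * ENNReal.ofReal (‖x‖ ^ 2) ^ (-σ) := by
  wlog hr : 0 ≤ r generalizing x r
  · have := this (-x) (-r) (by linarith)
    simpa only [neg_smul, ← neg_add, norm_neg] using this
  have hlim : Filter.Tendsto (fun k : ℕ => 1 / ((k : ℝ) + 1)) Filter.atTop (nhds 0) :=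
    tendsto_one_div_add_atTop_nhds_zero_nat
  have hbound : ∀ k : ℕ, ∫⁻ e, ENNReal.ofReal
      (‖x + r • (e : EuclideanSpace ℝ (Fin (m + 2)))‖ ^ 2 + 1 / ((k : ℝ) + 1)) ^ (-σ)
        ∂surfaceMeasure (m + 2)
      ≤ surfaceMeasure (m + 2) Set.univ * ENNReal.ofReal (‖x‖ ^ 2) ^ (-σ) := by
    intro k
    have hε : 0 < 1 / ((k : ℝ) + 1) := by positivity
    have hpos : ∀ t ∈ Set.Icc (-‖x‖) ‖x‖, 0 < shiftedNormSq x (1 / ((k : ℝ) + 1)) r t :=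
      fun t ht => shiftedNormSq_pos x hr (by positivity) ht
    have hI := integral_shiftedNormSq_rpow_le x hε hr hσ hσm
    calc _ = ∫⁻ e, ENNReal.ofReal (shiftedNormSq x (1 / ((k : ℝ) + 1)) r
            (inner ℝ x (e : EuclideanSpace ℝ (Fin (m + 2)))) ^ (-σ)) ∂surfaceMeasure (m + 2) := by
          refine lintegral_congr fun e => ?_
          rw [← ENNReal.ofReal_rpow_of_pos (hpos _ (inner_sphere_mem_Icc x e)),
            norm_add_smul_sphere_sq]
          congr 2
          unfold shiftedNormSq
          ring
      _ = ENNReal.ofReal (∫ e, shiftedNormSq x (1 / ((k : ℝ) + 1)) r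
            (inner ℝ x (e : EuclideanSpace ℝ (Fin (m + 2)))) ^ (-σ) ∂surfaceMeasure (m + 2)) :=
          (ofReal_integral_eq_lintegral_ofReal
            (integrable_sphere (continuous_shiftedNormSq_rpow x (-σ) hpos))
            (.of_forall fun e =>
              Real.rpow_nonneg (hpos _ (inner_sphere_mem_Icc x e)).le _)).symm
      _ ≤ ENNReal.ofReal ((surfaceMeasure (m + 2)).real Set.univ
            * (‖x‖ ^ 2 + 1 / ((k : ℝ) + 1)) ^ (-σ)) := ENNReal.ofReal_le_ofReal hI
      _ = surfaceMeasure (m + 2) Set.univ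
            * ENNReal.ofReal (‖x‖ ^ 2 + 1 / ((k : ℝ) + 1)) ^ (-σ) := by
          rw [ENNReal.ofReal_mul measureReal_nonneg, ofReal_measureReal,
            ENNReal.ofReal_rpow_of_pos (by positivity)]
      _ ≤ _ := by
          refine mul_le_mul' le_rfl ?_
          rw [ENNReal.rpow_neg, ENNReal.rpow_neg, ENNReal.inv_le_inv]
          exact ENNReal.rpow_le_rpow (ENNReal.ofReal_le_ofReal (by linarith)) hσ
  calc _ = ∫⁻ e, Filter.liminf (fun k : ℕ => ENNReal.ofReal
      (‖x + r • (e : EuclideanSpace ℝ (Fin (m + 2)))‖ ^ 2 + 1 / ((k : ℝ) + 1)) ^ (-σ))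
        Filter.atTop ∂surfaceMeasure (m + 2) := by
        refine lintegral_congr fun e => (Filter.Tendsto.liminf_eq ?_).symm
        refine ((ENNReal.continuous_rpow_const.comp ENNReal.continuous_ofReal).tendsto _).comp ?_
        simpa using hlim.const_add (‖x + r • (e : EuclideanSpace ℝ (Fin (m + 2)))‖ ^ 2)
    _ ≤ Filter.liminf (fun k : ℕ => ∫⁻ e, ENNReal.ofReal
      (‖x + r • (e : EuclideanSpace ℝ (Fin (m + 2)))‖ ^ 2 + 1 / ((k : ℝ) + 1)) ^ (-σ)
        ∂surfaceMeasure (m + 2)) Filter.atTop := by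
        refine lintegral_liminf_le fun k => ?_
        exact (ENNReal.continuous_rpow_const.comp
          (ENNReal.continuous_ofReal.comp (by fun_prop))).measurable
    _ ≤ _ := Filter.liminf_le_of_frequently_le' (.of_forall hbound)

theorem surfaceMeasure_univ_ne_zero (m : ℕ) : surfaceMeasure (m + 2) Set.univ ≠ 0 := by
  rw [Measure.measure_univ_ne_zero, surfaceMeasure]
  exact Measure.toSphere_ne_zero _

theorem laverage_norm_rpow_le {m : ℕ} (x : EuclideanSpace ℝ (Fin (m + 2))) (r : ℝ) {σ : ℝ}
    (hσ : 0 ≤ σ) (hσm : 2 * σ ≤ m) :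
    ⨍⁻ e, ENNReal.ofReal (‖x + r • (e : EuclideanSpace ℝ (Fin (m + 2)))‖ ^ 2) ^ (-σ)
        ∂surfaceMeasure (m + 2) ≤ ENNReal.ofReal (‖x‖ ^ 2) ^ (-σ) := by
  rw [laverage_eq]
  exact ENNReal.div_le_of_le_mul' (lintegral_norm_rpow_le x r hσ hσm)

theorem lt_laverage_norm_rpow {m : ℕ} (x : EuclideanSpace ℝ (Fin (m + 2))) {r σ : ℝ}
    (hr : 0 < r) (hrx : r < ‖x‖) (hσ : 0 < σ) (hσm : m < 2 * σ) :
    ENNReal.ofReal (‖x‖ ^ 2) ^ (-σ) <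
    ⨍⁻ e, ENNReal.ofReal (‖x + r • (e : EuclideanSpace ℝ (Fin (m + 2)))‖ ^ 2) ^ (-σ)
        ∂surfaceMeasure (m + 2) := by
  have hpos : ∀ t ∈ Set.Icc (-‖x‖) ‖x‖, 0 < shiftedNormSq x 0 r t :=
    fun t ht => shiftedNormSq_pos x hr.le (by
      have := pow_pos (sub_pos.2 hrx) 2
      linarith) ht
  have hI := lt_integral_shiftedNormSq_rpow x hr hrx hσ hσm
  rw [laverage_eq, ENNReal.lt_div_iff_mul_lt (.inl (surfaceMeasure_univ_ne_zero m))
    (.inl (measure_ne_top _ _)), mul_comm]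
  calc _ = ENNReal.ofReal ((surfaceMeasure (m + 2)).real Set.univ * (‖x‖ ^ 2) ^ (-σ)) := by
        have : 0 < ‖x‖ := hr.trans hrx
        rw [ENNReal.ofReal_mul measureReal_nonneg, ofReal_measureReal,
            ENNReal.ofReal_rpow_of_pos (by positivity)]
    _ < ENNReal.ofReal (∫ e, shiftedNormSq x 0 r
            (inner ℝ x (e : EuclideanSpace ℝ (Fin (m + 2)))) ^ (-σ) ∂surfaceMeasure (m + 2)) :=
        (ENNReal.ofReal_lt_ofReal_iff_of_nonneg (by positivity)).2 hI
    _ = ∫⁻ e, ENNReal.ofReal (shiftedNormSq x 0 r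
            (inner ℝ x (e : EuclideanSpace ℝ (Fin (m + 2)))) ^ (-σ)) ∂surfaceMeasure (m + 2) :=
        ofReal_integral_eq_lintegral_ofReal
            (integrable_sphere (continuous_shiftedNormSq_rpow x (-σ) hpos))
            (.of_forall fun e =>
              Real.rpow_nonneg (hpos _ (inner_sphere_mem_Icc x e)).le _)
    _ = _ := by
        refine lintegral_congr fun e => ?_
        rw [← ENNReal.ofReal_rpow_of_pos (hpos _ (inner_sphere_mem_Icc x e)),
            norm_add_smul_sphere_sq]

/-! ### The columnwise prior -/

theorem extendedMean_coe_ennreal {α : Type*} [MeasurableSpace α] (μ : Measure α)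
    (g : α → ENNReal) : extendedMean μ (fun x => (g x : EReal)) = ((⨍⁻ x, g x ∂μ : ENNReal) : EReal) := by
  have h : ∀ x, (-(g x : EReal)).toENNReal = 0 := fun x =>
    EReal.toENNReal_of_nonpos
      (by rw [EReal.neg_le, neg_zero]; exact EReal.coe_ennreal_nonneg _)
  simp only [extendedMean, h, EReal.toENNReal_coe]
  simp

/-- A column of a matrix as a Euclidean vector. -/
def euclideanColumn {n p : ℕ} (X : Matrix (Fin n) (Fin p) ℝ) (i : Fin p) :
    EuclideanSpace ℝ (Fin n) := WithLp.toLp 2 fun a => X a i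

theorem sum_sq_eq_norm_euclideanColumn {n p : ℕ} (X : Matrix (Fin n) (Fin p) ℝ) (i : Fin p) :
    ∑ a, X a i ^ 2 = ‖euclideanColumn X i‖ ^ 2 := by
  rw [EuclideanSpace.real_norm_sq_eq]; rfl

theorem euclideanColumn_add_vecMulVec {n p : ℕ} (X : Matrix (Fin n) (Fin p) ℝ)
    (e : EuclideanSpace ℝ (Fin n)) (ρ : Fin p → ℝ) (i : Fin p) :
    euclideanColumn (X + Matrix.vecMulVec e.ofLp ρ) i = euclideanColumn X i + ρ i • e := by
  ext a
  simp [euclideanColumn, Matrix.vecMulVec_apply, mul_comm]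

theorem rankOneMean_columnwisePrior {n p : ℕ} (c : ℝ) (X : Matrix (Fin n) (Fin p) ℝ)
    (ρ : Fin p → ℝ) :
    rankOneMean (columnwisePrior n p c) X ρ =
      ((⨍⁻ e, ∏ i, ENNReal.ofReal
        (‖euclideanColumn X i + ρ i • (e : EuclideanSpace ℝ (Fin n))‖ ^ 2) ^ (-c / 2)
        ∂surfaceMeasure n : ENNReal) : EReal) := by
  unfold rankOneMean columnwisePrior
  rw [extendedMean_coe_ennreal]
  simp only [sum_sq_eq_norm_euclideanColumn, euclideanColumn_add_vecMulVec]

/-- Multiplication on `[0, ∞]` fails to be continuous only where `0` meets `∞`. The factors of the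
prior, being inverses of finite powers, never vanish. -/
theorem ENNReal.continuous_finsetProd_of_ne_zero {α ι : Type*} [TopologicalSpace α]
    {f : ι → α → ENNReal} (s : Finset ι) (hf : ∀ i ∈ s, Continuous (f i))
    (h0 : ∀ i ∈ s, ∀ x, f i x ≠ 0) : Continuous fun x => ∏ i ∈ s, f i x := by
  classical
  induction s using Finset.induction with
  | empty => simpa using continuous_const
  | insert i s hi ih =>
    simp only [Finset.prod_insert hi]
    have hs := ih (fun j hj => hf j (Finset.mem_insert_of_mem hj))
      (fun j hj => h0 j (Finset.mem_insert_of_mem hj))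
    refine continuous_iff_continuousAt.2 fun x => ENNReal.Tendsto.mul
      ((hf i (Finset.mem_insert_self i s)).tendsto x) (.inl (h0 i (Finset.mem_insert_self i s) x))
      (hs.tendsto x) (.inl ?_)
    exact Finset.prod_ne_zero_iff.2 fun j hj => h0 j (Finset.mem_insert_of_mem hj) x

theorem continuous_columnwisePrior (n p : ℕ) {c : ℝ} (hc : 0 ≤ c) :
    Continuous (columnwisePrior n p c) := by
  refine continuous_coe_ennreal_ereal.comp
    (ENNReal.continuous_finsetProd_of_ne_zero _ (fun i _ => ?_) fun i _ M => ?_)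
  · exact ENNReal.continuous_rpow_const.comp (ENNReal.continuous_ofReal.comp (by fun_prop))
  · rw [neg_div, ENNReal.rpow_neg]
    exact ENNReal.inv_ne_zero.2 (ENNReal.rpow_ne_top_of_nonneg (by positivity) ENNReal.ofReal_ne_top)

theorem columnwisePrior_mean_le {m p : ℕ} (hp : 1 ≤ p) {c : ℝ} (hc : 0 ≤ c)
    (hcm : c * p ≤ m) (X : Matrix (Fin (m + 2)) (Fin p) ℝ) (ρ : Fin p → ℝ) :
    rankOneMean (columnwisePrior (m + 2) p c) X ρ ≤ columnwisePrior (m + 2) p c X := by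
  have hp0 : (0 : ℝ) < p := by exact_mod_cast hp
  rw [rankOneMean_columnwisePrior, columnwisePrior, EReal.coe_ennreal_le_coe_ennreal_iff]
  simp only [sum_sq_eq_norm_euclideanColumn]
  have hexp : ∀ z : ENNReal, z ^ (-c / 2) = (z ^ (-(c * p / 2))) ^ (1 / (p : ℝ)) := by
    intro z
    rw [← ENNReal.rpow_mul]
    congr 1
    field_simp
  simp only [hexp]
  -- The mean becomes an integral against the normalized measure, so Hölder's inequality gives a
  -- product of means.
  rw [laverage]
  refine (ENNReal.lintegral_prod_norm_pow_le Finset.univ (fun i _ => ?_) ?_ ?_).trans ?_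
  · exact (ENNReal.continuous_rpow_const.comp
      (ENNReal.continuous_ofReal.comp (by fun_prop))).measurable.aemeasurable
  · simp [hp0.ne']
  · intro i _; positivity
  · refine Finset.prod_le_prod' fun i _ => ENNReal.rpow_le_rpow ?_ (by positivity)
    exact laverage_norm_rpow_le _ _ (by positivity) (by linarith)

theorem mainTheorem10 (n p : ℕ) (hn : 2 ≤ n) (hp : 1 ≤ p) (c : ℝ) (hc : 0 ≤ c) :
    IsMatrixSuperharmonic (columnwisePrior n p c) ↔ 0 ≤ c ∧ c ≤ ((n : ℝ) - 2) / (p : ℝ) := by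
  obtain ⟨m, rfl⟩ := Nat.exists_eq_add_of_le' hn
  have hp0 : (0 : ℝ) < p := by exact_mod_cast hp
  rw [le_div_iff₀ hp0]
  push_cast
  rw [add_sub_cancel_right]
  constructor
  · intro h
    refine ⟨hc, ?_⟩
    by_contra! hlt
    -- All columns equal the first basis vector and all `ρ i` equal `1 / 2`, so the `p` factors
    -- coincide; the radius `1 / 2 < 1` keeps the sphere away from the origin.
    have hle := h.mean_le (Matrix.of fun a _ => if a = 0 then 1 else 0) (fun _ => 1 / 2)
    rw [rankOneMean_columnwisePrior, columnwisePrior, EReal.coe_ennreal_le_coe_ennreal_iff] at hle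
    simp only [sum_sq_eq_norm_euclideanColumn] at hle
    have hcol : ∀ i : Fin p, euclideanColumn
        (Matrix.of fun (a : Fin (m + 2)) (_ : Fin p) => if a = 0 then (1 : ℝ) else 0) i
        = EuclideanSpace.single 0 1 := by
      intro i
      ext a
      simp [euclideanColumn]
    have hexp : ∀ z : ENNReal, (z ^ (-c / 2)) ^ p = z ^ (-(c * p / 2)) := by
      intro z
      rw [← ENNReal.rpow_mul_natCast]
      congr 1
      ring
    simp only [hcol, Finset.prod_const, Finset.card_univ, Fintype.card_fin, hexp] at hle
    refine absurd hle (not_le.2 (lt_laverage_norm_rpow _ (by norm_num) (by norm_num) ?_ ?_))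
    · have : (0 : ℝ) ≤ m := m.cast_nonneg
      linarith
    · linarith
  · rintro ⟨-, hcm⟩
    refine ⟨fun X => EReal.coe_ennreal_ne_bot _, (continuous_columnwisePrior _ _ hc).lowerSemicontinuous,
      ⟨Matrix.of fun _ _ => 1, ?_⟩, columnwisePrior_mean_le hp hc hcm⟩
    rw [Ne, columnwisePrior, EReal.coe_ennreal_eq_top_iff]
    refine ENNReal.prod_ne_top fun i _ => ?_
    rw [ENNReal.ofReal_rpow_of_pos (by simp; positivity)]
    exact ENNReal.ofReal_ne_top
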